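/- Let $P=(X,\le)$ be a finite poset. Its \emph{cover graph} is the graph on $X$ in which $x$ and $y$ are adjacent if and only if one of them covers the other. Let $\operatorname{MM}(P)$ be the set of all ordered pairs $(x,y)$ of incomparable elements of $P$ such that $x$ is minimal and $y$ is maximal in $P$. A set $I$ of ordered pairs of incomparable elements of $P$ is \emph{reversible} if there is a linear extension $L$ of $P$ such that $x>y$ in $L$ for every $(x,y)\in I$. Suppose that (i) the cover graph of $P$ has treewidth at most $2$, and (ii) $P$ has a minimal element $a_0$ such that $a_0<b$ for every maximal element $b$ of $P$. Then $\operatorname{MM}(P)$ can be partitioned into $638$ reversible sets (some of which may be empty). -/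

import Mathlib

namespace SimpleGraph

/-- A tree decomposition of `G` indexed by the graph `T`: a nonempty subtree of `T` for every vertex
of `G`, such that the subtrees of adjacent vertices share a node. A nonempty subtree of a tree is
given by its set of nodes, which is any set of nodes that induces a connected subgraph. -/
structure TreeDecomposition {V : Type*} (G : SimpleGraph V) {N : Type*} (T : SimpleGraph N) where
  isTree : T.IsTree
  nodes : V → Set N
  connected : ∀ x, (T.induce (nodes x)).Connected
  inter_nonempty : ∀ x y, G.Adj x y → (nodes x ∩ nodes y).Nonempty

/-- The bag of the node `u`: all vertices whose subtree contains `u`. -/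
def TreeDecomposition.bag {V : Type*} {G : SimpleGraph V} {N : Type*} {T : SimpleGraph N}
    (D : G.TreeDecomposition T) (u : N) : Set V :=
  {x | u ∈ D.nodes x}

/-- The treewidth of a graph: the least `t` such that there is a tree decomposition, over a finite
tree, all of whose bags have at most `t + 1` elements (and `⊤` if there is none, which does not
happen for finite graphs). As finite trees live in `Type` up to isomorphism, nothing is lost by
taking the nodes there. -/
noncomputable def treewidth {V : Type*} (G : SimpleGraph V) : ℕ∞ :=
  sInf {t : ℕ∞ | ∃ (N : Type) (_ : Finite N) (T : SimpleGraph N) (D : G.TreeDecomposition T),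
    t ≠ ⊤ ∧ ∀ u, (D.bag u).encard ≤ t + 1}

end SimpleGraph

/-- The set `Inc(P)` of ordered pairs of incomparable elements. -/
def incPairs (α : Type*) [PartialOrder α] : Set (α × α) :=
  {p | IncompRel (· ≤ ·) p.1 p.2}

/-- The set `MM(P)` of min-max pairs: incomparable pairs consisting of a minimal and a maximal
element. -/
def minMaxPairs (α : Type*) [PartialOrder α] : Set (α × α) :=
  {p | p ∈ incPairs α ∧ IsMin p.1 ∧ IsMax p.2}

/-- A set of pairs is reversible if some linear extension puts `x` above `y` for each of its
pairs `(x, y)`. -/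
def IsReversible {α : Type*} [PartialOrder α] (I : Set (α × α)) : Prop :=
  I ⊆ incPairs α ∧
    ∃ L : LinearOrder α, (∀ x y : α, x ≤ y → L.le x y) ∧ ∀ p ∈ I, L.lt p.2 p.1

/-! A graph of treewidth at most 2 lies in a 2-tree, which can be built from the root `a₀` by
attaching each new vertex `n` to an edge with ends `lo n` and `hi n`. These at most two vertices
separate the descendants of `n` from all other vertices, so every comparability crossing that
boundary passes through one of them. As `a₀` is below every maximal `b`, some separator of every
non-root ancestor of `b` is below `b`.

The up-set of `a` is connected, so it has an element `top a` that is an ancestor of all the others.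
Six classes of pairs suffice. If `b` is not a descendant of `top a`, it comes before or after `top
a` in the preorder of the tree (two classes). Otherwise `b` lies below a right or a left child of
`top a`, and `a` comes before or after `b` (four classes). A class that is not reversible contains a
strict alternating cycle. In the first two classes the cycle would be strictly monotone in the
preorder (`isReversible_of_not_anc_top`). In the other four, one examines how the cycle moves
between the branches at the deepest common ancestor of all its elements `b`
(`false_of_rightBelowTop`); reflection reduces left to right. -/

/-! ### Ladder trees and their ancestor order -/

/-- A rooted tree on the vertices of `G` that exhibits `G` as a subgraph of a 2-tree: every vertex
`n` other than the root is attached to the edge with ends `lo n` and `hi n`, one of which is the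
parent of `n`, and replaces `lo (par n)` or `hi (par n)` by the parent. The list `path n` encodes
the path from the root to `n`. -/
structure LadderTree {α : Type*} (G : SimpleGraph α) (r : α) where
  par : α → α
  right : α → Prop
  lo : α → Option α
  hi : α → Option α
  path : α → List ℕ
  path_injective : Function.Injective path
  exists_path_eq : ∀ n, n ≠ r → ∃ k, path n = path (par n) ++ [k]
  lo_root : lo r = none
  hi_root : hi r = none
  lo_of_right : ∀ n, n ≠ r → right n → lo n = some (par n)
  hi_of_right : ∀ n, n ≠ r → right n → hi n = hi (par n)
  lo_of_left : ∀ n, n ≠ r → ¬ right n → lo n = lo (par n)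
  hi_of_left : ∀ n, n ≠ r → ¬ right n → hi n = some (par n)
  adj : ∀ x y, G.Adj x y → lo y = some x ∨ hi y = some x ∨ lo x = some y ∨ hi x = some y

namespace LadderTree

variable {α : Type*} {G : SimpleGraph α} {r : α} (T : LadderTree G r)

/-- The reflection of a ladder tree, which exchanges left and right. -/
def mirror : LadderTree G r where
  par := T.par
  right n := ¬ T.right n
  lo := T.hi
  hi := T.lo
  path := T.path
  path_injective := T.path_injective
  exists_path_eq := T.exists_path_eq
  lo_root := T.hi_root
  hi_root := T.lo_root
  lo_of_right := T.hi_of_left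
  hi_of_right := T.lo_of_left
  lo_of_left n hn h := T.hi_of_right n hn (not_not.1 h)
  hi_of_left n hn h := T.lo_of_right n hn (not_not.1 h)
  adj x y h := by have := T.adj x y h; tauto

/-- `n` is an ancestor of `m`, or equal to it. -/
def Anc (n m : α) : Prop := T.path n <+: T.path m

variable {T}

theorem Anc.refl (n : α) : T.Anc n n := List.prefix_rfl

theorem Anc.trans {a b c : α} (h : T.Anc a b) (h' : T.Anc b c) : T.Anc a c :=
  List.IsPrefix.trans h h'

theorem Anc.antisymm {a b : α} (h : T.Anc a b) (h' : T.Anc b a) : a = b :=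
  T.path_injective (h.eq_of_length (le_antisymm h.length_le h'.length_le))

theorem Anc.total {a b c : α} (h : T.Anc a c) (h' : T.Anc b c) : T.Anc a b ∨ T.Anc b a :=
  List.prefix_or_prefix_of_prefix h h'

theorem Anc.length_lt {a b : α} (h : T.Anc a b) (hne : a ≠ b) :
    (T.path a).length < (T.path b).length :=
  lt_of_le_of_ne h.length_le fun h' => hne (T.path_injective (h.eq_of_length h'))

theorem anc_iff {n m : α} (hm : m ≠ r) : T.Anc n m ↔ n = m ∨ T.Anc n (T.par m) := by
  obtain ⟨k, hk⟩ := T.exists_path_eq m hm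
  unfold Anc
  rw [hk, List.prefix_concat_iff, ← hk, T.path_injective.eq_iff]

theorem par_anc {m : α} (hm : m ≠ r) : T.Anc (T.par m) m :=
  (anc_iff hm).2 (Or.inr (Anc.refl _))

theorem length_par_lt {m : α} (hm : m ≠ r) :
    (T.path (T.par m)).length < (T.path m).length := by
  obtain ⟨k, hk⟩ := T.exists_path_eq m hm
  simp [hk]

theorem par_ne {m : α} (hm : m ≠ r) : T.par m ≠ m := fun h => by
  have := T.length_par_lt hm
  rw [h] at this
  exact this.false

variable (T) in
/-- Induction from the parent to the child. -/
theorem par_induction {p : α → Prop} (root : p r) (step : ∀ n, n ≠ r → p (T.par n) → p n)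
    (n : α) : p n := by
  induction h : (T.path n).length using Nat.strong_induction_on generalizing n with
  | _ k ih =>
    by_cases hn : n = r
    · exact hn ▸ root
    · exact step n hn (ih _ (h ▸ T.length_par_lt hn) _ rfl)

theorem root_anc (n : α) : T.Anc r n :=
  T.par_induction (Anc.refl r) (fun _ hn ih => ih.trans (par_anc hn)) n

theorem anc_root_iff {n : α} : T.Anc n r ↔ n = r :=
  ⟨fun h => h.antisymm (root_anc n), fun h => h ▸ Anc.refl _⟩

theorem exists_child {n m : α} (h : T.Anc n m) (hne : n ≠ m) :
    ∃ d, d ≠ r ∧ T.par d = n ∧ T.Anc d m := by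
  revert h hne
  refine T.par_induction (p := fun m => T.Anc n m → n ≠ m →
    ∃ d, d ≠ r ∧ T.par d = n ∧ T.Anc d m) ?_ ?_ m
  · intro h hne
    exact absurd (anc_root_iff.1 h) hne
  · intro m hm ih h hne
    by_cases hn : n = T.par m
    · exact ⟨m, hm, hn.symm, Anc.refl m⟩
    · obtain ⟨d, hd, hd', hdm⟩ := ih (((anc_iff hm).1 h).resolve_left hne) hn
      exact ⟨d, hd, hd', hdm.trans (par_anc hm)⟩

theorem child_unique {d d' m : α} (hd : d ≠ r) (hd' : d' ≠ r) (hp : T.par d = T.par d')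
    (h : T.Anc d m) (h' : T.Anc d' m) : d = d' := by
  rcases h.total h' with h | h
  · refine ((anc_iff hd').1 h).resolve_right fun h => ?_
    exact par_ne hd ((par_anc hd).antisymm (hp ▸ h))
  · refine (((anc_iff hd).1 h).resolve_right fun h => ?_).symm
    exact par_ne hd' ((par_anc hd').antisymm (hp ▸ h))

/-! ### Separators -/

variable (T) in
/-- The ends of the edge to which `n` is attached. -/
def Sep (n s : α) : Prop := T.lo n = some s ∨ T.hi n = some s

theorem sep_anc {n s : α} (h : T.Sep n s) : n ≠ r ∧ T.Anc s (T.par n) := by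
  revert h
  refine T.par_induction (p := fun n => T.Sep n s → n ≠ r ∧ T.Anc s (T.par n)) ?_ ?_ n
  · rintro (h | h)
    · simp [T.lo_root] at h
    · simp [T.hi_root] at h
  · intro n hn ih h
    refine ⟨hn, ?_⟩
    have key : s = T.par n ∨ T.Sep (T.par n) s := by
      by_cases hr : T.right n
      · rw [Sep, T.lo_of_right n hn hr, T.hi_of_right n hn hr] at h
        rcases h with h | h
        · exact Or.inl (Option.some.inj h).symm
        · exact Or.inr (Or.inr h)
      · rw [Sep, T.lo_of_left n hn hr, T.hi_of_left n hn hr] at h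
        rcases h with h | h
        · exact Or.inr (Or.inl h)
        · exact Or.inl (Option.some.inj h).symm
    rcases key with rfl | h'
    · exact Anc.refl _
    · exact (ih h').2.trans (par_anc (ih h').1)

theorem Sep.anc {n s : α} (h : T.Sep n s) : T.Anc s n :=
  (sep_anc h).2.trans (par_anc (sep_anc h).1)

theorem Sep.not_anc {n s : α} (h : T.Sep n s) : ¬ T.Anc n s := fun h' => by
  have h1 := sep_anc h
  exact par_ne h1.1 ((par_anc h1.1).antisymm (h'.trans h1.2))

theorem Sep.of_right {n s : α} (hn : n ≠ r) (hr : T.right n) (h : T.Sep n s) :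
    s = T.par n ∨ T.hi (T.par n) = some s := by
  rw [Sep, T.lo_of_right n hn hr, T.hi_of_right n hn hr] at h
  exact h.imp (fun h => (Option.some.inj h).symm) id

theorem Sep.of_left {n s : α} (hn : n ≠ r) (hr : ¬ T.right n) (h : T.Sep n s) :
    s = T.par n ∨ T.lo (T.par n) = some s := by
  rw [Sep, T.lo_of_left n hn hr, T.hi_of_left n hn hr] at h
  exact h.symm.imp (fun h => (Option.some.inj h).symm) id

theorem Sep.of_par {n s : α} (hn : n ≠ r) (h : T.Sep n s) : s = T.par n ∨ T.Sep (T.par n) s := by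
  by_cases hr : T.right n
  · exact (h.of_right hn hr).imp_right Or.inr
  · exact (h.of_left hn hr).imp_right Or.inl

/-- Passing from a vertex to its child adds only the parent to the separator, so an end outside the
subtree of `n` was already present at `n`. -/
theorem Sep.of_anc {n y z : α} (h : T.Sep y z) (hny : T.Anc n y) (hnz : ¬ T.Anc n z) :
    T.Sep n z := by
  revert h hny
  refine T.par_induction (p := fun y => T.Sep y z → T.Anc n y → T.Sep n z) ?_ ?_ y
  · intro h h'
    rwa [anc_root_iff.1 h']
  · intro y hy ih h hny
    rcases (anc_iff hy).1 hny with rfl | hny'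
    · exact h
    · rcases h.of_par hy with rfl | h'
      · exact absurd hny' hnz
      · exact ih h' hny'

theorem sep_of_adj {n y z : α} (h : G.Adj y z) (hny : T.Anc n y) (hnz : ¬ T.Anc n z) :
    T.Sep n z := by
  have h' : T.Sep y z ∨ T.Sep z y := by
    have := T.adj y z h
    unfold Sep
    tauto
  rcases h' with h' | h'
  · exact h'.of_anc hny hnz
  · exact absurd (hny.trans h'.anc) hnz

/-! ### Comparabilities across a separator -/

section Poset

variable {β : Type*} [PartialOrder β] [Finite β] {r : β} {T : LadderTree (SimpleGraph.hasse β) r}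

theorem _root_.le_iff_reflTransGen_covBy_of_finite {x y : β} :
    x ≤ y ↔ Relation.ReflTransGen (· ⋖ ·) x y := by
  classical
  have := Fintype.ofFinite β
  let _ : LocallyFiniteOrder β := Fintype.toLocallyFiniteOrder
  exact le_iff_reflTransGen_covBy

theorem exists_sep_of_le {n y z : β} (h : y ≤ z) (hy : T.Anc n y) (hz : ¬ T.Anc n z) :
    ∃ s, T.Sep n s ∧ y ≤ s ∧ s ≤ z := by
  revert hy
  induction le_iff_reflTransGen_covBy_of_finite.1 h using
    Relation.ReflTransGen.head_induction_on with
  | refl => exact fun hy => absurd hy hz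
  | @head y y' h1 h2 ih =>
    intro hy
    have h2' := le_iff_reflTransGen_covBy_of_finite.2 h2
    by_cases hy' : T.Anc n y'
    · obtain ⟨s, hs, h3, h4⟩ := ih h2' hy'
      exact ⟨s, hs, h1.le.trans h3, h4⟩
    · exact ⟨y', sep_of_adj (Or.inl h1) hy hy', h1.le, h2'⟩

theorem exists_sep_of_ge {n y z : β} (h : y ≤ z) (hy : ¬ T.Anc n y) (hz : T.Anc n z) :
    ∃ s, T.Sep n s ∧ y ≤ s ∧ s ≤ z := by
  revert hz
  induction le_iff_reflTransGen_covBy_of_finite.1 h with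
  | refl => exact fun hz => absurd hz hy
  | @tail z' z h1 h2 ih =>
    intro hz
    have h1' := le_iff_reflTransGen_covBy_of_finite.2 h1
    by_cases hz' : T.Anc n z'
    · obtain ⟨s, hs, h3, h4⟩ := ih h1' hz'
      exact ⟨s, hs, h3, h4.trans h2.le⟩
    · exact ⟨z', sep_of_adj (Or.inr h2) hz hz', h1', h2.le⟩

/-- The root is outside the subtree of `n`, so a chain from the root to `b` must cross the
separator. The assumption on `a₀` enters through this lemma. -/
theorem exists_sep_le {n b : β} (hb : r ≤ b) (hn : n ≠ r) (h : T.Anc n b) :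
    ∃ s, T.Sep n s ∧ s ≤ b := by
  obtain ⟨s, hs, _, h'⟩ := exists_sep_of_ge hb (fun h => hn (anc_root_iff.1 h)) h
  exact ⟨s, hs, h'⟩

variable (T) in
-- Take an element of the up-set at least depth. Separators of its subtree are strictly less deep,
-- hence not in the up-set, so no chain in the up-set leaves the subtree.
theorem exists_top (a : β) : ∃ x, a ≤ x ∧ ∀ z, a ≤ z → T.Anc x z := by
  obtain ⟨x, hx, hmin⟩ := Set.exists_min_image (Set.Ici a) (fun x => (T.path x).length)
    (Set.toFinite _) ⟨a, le_rfl⟩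
  have hnot : ∀ s, T.Sep x s → ¬ a ≤ s := fun s hs has =>
    absurd (hmin s has) (not_le.2 (hs.anc.length_lt fun h => hs.not_anc (h ▸ Anc.refl _)))
  have hax : T.Anc x a := by
    by_contra h
    obtain ⟨s, hs, h1, _⟩ := exists_sep_of_ge hx h (Anc.refl x)
    exact hnot s hs h1
  refine ⟨x, hx, fun z hz => ?_⟩
  by_contra h
  obtain ⟨s, hs, h1, _⟩ := exists_sep_of_le hz hax h
  exact hnot s hs h1

end Poset

end LadderTree

/-! ### Alternating cycles and reversibility -/

/-- A strict alternating cycle of pairs in `I`. The indices form a single cycle under `succ`,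
which is expressed by an induction principle. -/
structure StrictAlternatingCycle {α : Type*} [PartialOrder α] (I : Set (α × α)) (ι : Type*) where
  succ : ι → ι
  a : ι → α
  b : ι → α
  mem : ∀ i, (a i, b i) ∈ I
  le_succ : ∀ i, a i ≤ b (succ i)
  eq_succ : ∀ i j, a i ≤ b j → j = succ i
  induct : ∀ S : Set ι, S.Nonempty → (∀ i ∈ S, succ i ∈ S) → S = Set.univ

namespace StrictAlternatingCycle

variable {α : Type*} [PartialOrder α] {I : Set (α × α)} {ι : Type*}
  (C : StrictAlternatingCycle I ι)

theorem const_of_forall_succ {β : Type*} {D : ι → β} (h : ∀ i, D (C.succ i) = D i) (i j : ι) :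
    D i = D j := by
  have := C.induct {i | D i = D j} ⟨j, rfl⟩ fun i hi => (h i).trans hi
  exact (this ▸ Set.mem_univ i : i ∈ {i | D i = D j})

theorem antitone_const {β : Type*} [PartialOrder β] {f : ι → β} (h : ∀ i, f (C.succ i) ≤ f i)
    (i : ι) : f (C.succ i) = f i := by
  have key : ∀ i j, f i ≤ f j := fun i j => by
    have := C.induct {i | f i ≤ f j} ⟨j, le_rfl⟩ fun i hi => (h i).trans hi
    exact (this ▸ Set.mem_univ i : i ∈ {i | f i ≤ f j})
  exact le_antisymm (key _ _) (key _ _)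

theorem exists_change_from {β : Type*} {D : ι → β} {i₀ : ι} (h : D (C.succ i₀) ≠ D i₀) (i : ι) :
    ∃ j, D j = D i ∧ D (C.succ j) ≠ D j := by
  by_contra! hc
  have := C.induct {j | D j = D i} ⟨i, rfl⟩ fun j hj => (hc j hj).trans hj
  have key : ∀ j, D j = D i := fun j => (this ▸ Set.mem_univ j : j ∈ {j | D j = D i})
  exact h ((key _).trans (key _).symm)

theorem exists_change_to {β : Type*} {D : ι → β} {i₀ : ι} (h : D (C.succ i₀) ≠ D i₀) (i : ι) :
    ∃ j, D (C.succ j) = D i ∧ D (C.succ j) ≠ D j := by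
  by_contra! hc
  have key : ∀ j, D j = D i := by
    intro j
    by_contra hj
    have := C.induct {j | D j ≠ D i} ⟨j, hj⟩ fun j hj hj' => hj ((hc j hj').symm.trans hj')
    exact (this ▸ Set.mem_univ i : i ∈ {j | D j ≠ D i}) rfl
  exact h ((key _).trans (key _).symm)

end StrictAlternatingCycle

section

variable {α : Type*} [PartialOrder α] {I : Set (α × α)}

/-- A minimal set of pairs, each of which has a successor in the set, is a strict alternating
cycle. -/
theorem exists_strictAlternatingCycle [Finite α] {C : Set (α × α)} (hne : C.Nonempty) (hCI : C ⊆ I)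
    (hC : ∀ p ∈ C, ∃ q ∈ C, p.1 ≤ q.2) :
    ∃ D : Set (α × α), D.Nonempty ∧ Nonempty (StrictAlternatingCycle I D) := by
  classical
  obtain ⟨D, ⟨hDne, hDI, hD⟩, hmin⟩ := Set.exists_min_image
    {C : Set (α × α) | C.Nonempty ∧ C ⊆ I ∧ ∀ p ∈ C, ∃ q ∈ C, p.1 ≤ q.2} Set.ncard
    (Set.toFinite _) ⟨C, hne, hCI, hC⟩
  -- By minimality of `D`, a nonempty subset closed under any choice of successors is all of `D`.
  have hall : ∀ f : D → D, (∀ p : D, (p : α × α).1 ≤ (f p : α × α).2) →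
      ∀ S : Set D, S.Nonempty → (∀ p ∈ S, f p ∈ S) → S = Set.univ := by
    intro f hf S hS hSf
    have h1 : ((↑) '' S : Set (α × α)) ⊆ D := by
      rintro _ ⟨p, _, rfl⟩
      exact p.2
    have h2 : D.ncard ≤ ((↑) '' S : Set (α × α)).ncard := by
      refine hmin _ ⟨hS.image _, h1.trans hDI, ?_⟩
      rintro _ ⟨p, hp, rfl⟩
      exact ⟨f p, ⟨f p, hSf p hp, rfl⟩, hf p⟩
    have h3 := Set.eq_of_subset_of_ncard_le h1 h2
    refine Set.eq_univ_of_forall fun p => ?_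
    obtain ⟨q, hq, hqp⟩ : (p : α × α) ∈ ((↑) '' S : Set (α × α)) := h3.symm ▸ p.2
    exact Subtype.ext hqp ▸ hq
  have hex : ∀ p : D, ∃ q : D, (p : α × α).1 ≤ (q : α × α).2 := fun p => by
    obtain ⟨q, hq, h⟩ := hD p p.2
    exact ⟨⟨q, hq⟩, h⟩
  choose f hf using hex
  have hsurj : Function.Surjective f := by
    rw [← Set.range_eq_univ]
    obtain ⟨p, hp⟩ := hDne
    exact hall f hf _ ⟨_, ⟨p, hp⟩, rfl⟩ fun p _ => ⟨p, rfl⟩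
  have hinj : Function.Injective f := Finite.injective_iff_surjective.2 hsurj
  refine ⟨D, hDne, ⟨⟨f, fun p => p.1.1, fun p => p.1.2, fun p => hDI p.2, hf, ?_, hall f hf⟩⟩⟩
  intro p q hpq
  -- Redirect `p` to the alternative successor `q`. The `f`-orbit of `q` up to the first visit to
  -- `p` is closed under `g`, so it contains `f p`; since `f` is injective, `f p` can only be its
  -- starting point `q`.
  set g : D → D := Function.update f p q with hg
  have hg' : ∀ p' : D, (p' : α × α).1 ≤ (g p' : α × α).2 := by
    intro p'
    by_cases h : p' = p
    · subst h
      simpa [hg] using hpq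
    · simpa [hg, h] using hf p'
  have hS := hall g hg' {y | ∃ k, y = f^[k] q ∧ ∀ j < k, f^[j] q ≠ p} ⟨q, 0, rfl, by simp⟩ (by
    rintro _ ⟨k, rfl, hk⟩
    by_cases h : f^[k] q = p
    · rw [h]
      exact ⟨0, by simp [hg], by simp⟩
    · refine ⟨k + 1, ?_, fun j hj => ?_⟩
      · simp [hg, h, Function.iterate_succ_apply']
      · rcases Nat.lt_succ_iff_lt_or_eq.1 hj with hj | rfl
        · exact hk j hj
        · exact h)
  obtain ⟨k, hk, hk'⟩ := hS.symm ▸ Set.mem_univ (f p)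
  cases k with
  | zero => exact hk.symm
  | succ k =>
    rw [Function.iterate_succ_apply'] at hk
    exact absurd (hinj hk).symm (hk' k k.lt_succ_self)

/-- A set of incomparable pairs without alternating cycles is reversible. -/
theorem isReversible_of_not_transGen (hI : I ⊆ incPairs α)
    (h : ∀ p, ¬ Relation.TransGen (fun p q => p ∈ I ∧ q ∈ I ∧ p.1 ≤ q.2) p p) :
    IsReversible I := by
  set E : α × α → α × α → Prop := fun p q => p ∈ I ∧ q ∈ I ∧ p.1 ≤ q.2 with hE
  -- The order generated by `≤` and the reversed pairs; a failure of antisymmetry would give an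
  -- alternating cycle.
  set s : α → α → Prop := fun x y => x ≤ y ∨
    ∃ p q, p ∈ I ∧ q ∈ I ∧ x ≤ p.2 ∧ Relation.ReflTransGen E p q ∧ q.1 ≤ y with hs
  have : IsPartialOrder α s :=
    { refl := fun x => Or.inl le_rfl
      trans := by
        rintro x y z (hxy | ⟨p, q, hp, hq, h1, h2, h3⟩) (hyz | ⟨p', q', hp', hq', h1', h2', h3'⟩)
        · exact Or.inl (hxy.trans hyz)
        · exact Or.inr ⟨p', q', hp', hq', hxy.trans h1', h2', h3'⟩
        · exact Or.inr ⟨p, q, hp, hq, h1, h2, h3.trans hyz⟩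
        · exact Or.inr ⟨p, q', hp, hq', h1,
            h2.trans (.head ⟨hq, hp', h3.trans h1'⟩ h2'), h3'⟩
      antisymm := by
        rintro x y (hxy | ⟨p, q, hp, hq, h1, h2, h3⟩) (hyx | ⟨p', q', hp', hq', h1', h2', h3'⟩)
        · exact le_antisymm hxy hyx
        · exact absurd (.head' ⟨hq', hp', (h3'.trans hxy).trans h1'⟩ h2') (h q')
        · exact absurd (.head' ⟨hq, hp, (h3.trans hyx).trans h1⟩ h2) (h q)
        · exact absurd (.head' ⟨hq, hp', h3.trans h1'⟩
            (h2'.trans (.head ⟨hq', hp, h3'.trans h1⟩ h2))) (h q) }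
  obtain ⟨t, ht, hst⟩ := extend_partialOrder s
  classical
  let L : LinearOrder α :=
    { le := t
      lt := fun x y => t x y ∧ ¬ t y x
      le_refl := ht.refl
      le_trans := ht.trans
      le_antisymm := ht.antisymm
      le_total := ht.total
      toDecidableLE := Classical.decRel t }
  refine ⟨hI, L, fun x y hxy => hst x y (Or.inl hxy), ?_⟩
  intro p hp
  have h1 : t p.2 p.1 := hst _ _ (Or.inr ⟨p, p, hp, hp, le_rfl, .refl, le_rfl⟩)
  refine ⟨h1, fun h2 => (hI hp).1 (ht.antisymm _ _ h2 h1).le⟩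

theorem isReversible_of_isEmpty_cycle [Finite α] (hI : I ⊆ incPairs α)
    (h : ∀ D : Set (α × α), D.Nonempty → StrictAlternatingCycle I D → False) :
    IsReversible I := by
  refine isReversible_of_not_transGen hI fun p hp => ?_
  set E : α × α → α × α → Prop := fun p q => p ∈ I ∧ q ∈ I ∧ p.1 ≤ q.2 with hE
  obtain ⟨D, hD, ⟨C⟩⟩ := exists_strictAlternatingCycle (I := I) (C := {p | Relation.TransGen E p p})
    ⟨p, hp⟩ (fun p hp => by
      obtain ⟨q, hq, _⟩ := Relation.TransGen.head'_iff.1 hp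
      exact hq.1)
    (fun p hp => by
      obtain ⟨q, hq, hqp⟩ := Relation.TransGen.head'_iff.1 hp
      exact ⟨q, Relation.TransGen.tail' hqp hq, hq.2.2⟩)
  exact h D hD C

end

/-! ### Preorder of the tree: subtrees are lexicographic intervals -/

theorem List.IsPrefix.of_not_lt_of_not_lt {p x y z : List ℕ} (hx : p <+: x) (hz : p <+: z)
    (hxy : ¬ y < x) (hyz : ¬ z < y) : p <+: y := by
  induction p generalizing x y z with
  | nil => exact List.nil_prefix
  | cons k p ih =>
    obtain ⟨x, rfl⟩ := hx
    obtain ⟨z, rfl⟩ := hz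
    cases y with
    | nil => simp at hxy
    | cons l y =>
      simp only [List.cons_append, List.cons_lt_cons_iff, not_or, not_and] at hxy hyz
      have hkl : k = l := by omega
      subst hkl
      exact List.cons_prefix_cons.2
        ⟨rfl, ih (List.prefix_append _ _) (List.prefix_append _ _) (hxy.2 rfl) (hyz.2 rfl)⟩

namespace LadderTree

variable {α : Type*} [PartialOrder α] {r : α} {T : LadderTree (SimpleGraph.hasse α) r}

theorem Anc.path_le {n m : α} (h : T.Anc n m) : T.path n ≤ T.path m :=
  not_lt.1 (List.IsPrefix.le h)

theorem Anc.of_le_of_le {n x y z : α} (hx : T.Anc n x) (hz : T.Anc n z)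
    (hxy : T.path x ≤ T.path y) (hyz : T.path y ≤ T.path z) : T.Anc n y :=
  List.IsPrefix.of_not_lt_of_not_lt hx hz (not_lt.2 hxy) (not_lt.2 hyz)

variable (T) in
/-- `x` is the element of the up-set of `a` that is closest to the root. -/
def IsTop (a x : α) : Prop := a ≤ x ∧ ∀ z, a ≤ z → T.Anc x z

variable (T) in
/-- The element `b` lies on the right below the top of the up-set of `a`. -/
def RightBelowTop (a b : α) : Prop :=
  ∃ d, d ≠ r ∧ T.IsTop a (T.par d) ∧ T.right d ∧ T.Anc d b

/-! ### The six reversible classes -/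

variable [Finite α]

/-- Between the top of the up-set of `a` and `b`, an element above `a` lies on the left and one below
`b` lies on the right. -/
theorem exists_lo_hi {a b b' d : α} (hd : d ≠ r) (htop : T.IsTop a (T.par d)) (hright : T.right d)
    (hab : ¬ a ≤ b) (hb : r ≤ b) (hab' : a ≤ b') (n : α) (hdn : T.Anc d n) (hnb : T.Anc n b)
    (hnb' : T.Anc n b') : ∃ u v, T.lo n = some u ∧ T.hi n = some v ∧ a ≤ u ∧ v ≤ b := by
  revert hdn hnb hnb'
  refine T.par_induction (p := fun n => T.Anc d n → T.Anc n b → T.Anc n b' →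
    ∃ u v, T.lo n = some u ∧ T.hi n = some v ∧ a ≤ u ∧ v ≤ b) ?_ ?_ n
  · intro h
    exact absurd (anc_root_iff.1 h) hd
  · intro n hn ih hdn hnb hnb'
    have hnx : ¬ T.Anc n (T.par d) := fun h =>
      par_ne hd ((par_anc hd).antisymm (hdn.trans h))
    obtain ⟨s, hs, has⟩ : ∃ s, T.Sep n s ∧ a ≤ s := by
      by_cases hna : T.Anc n a
      · obtain ⟨s, hs, h, _⟩ := exists_sep_of_le htop.1 hna hnx
        exact ⟨s, hs, h⟩
      · obtain ⟨s, hs, h, _⟩ := exists_sep_of_ge hab' hna hnb'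
        exact ⟨s, hs, h⟩
    obtain ⟨t, ht, htb⟩ := exists_sep_le hb hn hnb
    have hst : s ≠ t := by
      rintro rfl
      exact hab (has.trans htb)
    rcases hs with hs | hs <;> rcases ht with ht | ht
    · exact absurd (Option.some.inj (hs.symm.trans ht)) hst
    · exact ⟨s, t, hs, ht, has, htb⟩
    · exfalso
      -- The roles cannot be exchanged: at `d` the low end is the top itself, which is above `a`,
      -- and further down one end is always inherited from the parent together with its role.
      rcases (anc_iff hn).1 hdn with rfl | hdn'
      · rw [T.lo_of_right d hd hright] at ht
        exact hab (htop.1.trans (Option.some.inj ht ▸ htb))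
      · obtain ⟨u, v, hu, hv, hau, hvb⟩ :=
          ih hdn' ((par_anc hn).trans hnb) ((par_anc hn).trans hnb')
        by_cases hr : T.right n
        · rw [T.hi_of_right n hn hr, hv] at hs
          exact hab (has.trans (Option.some.inj hs ▸ hvb))
        · rw [T.lo_of_left n hn hr, hu] at ht
          exact hab (hau.trans (Option.some.inj ht ▸ htb))
    · exact absurd (Option.some.inj (hs.symm.trans ht)) hst

/-- Let `c` be the deepest common ancestor of all `b i`. The cycle must jump between the branches at
`c`, and at a jump `a i` lies below `c` or `lo c` but never below `hi c`. Strictness allows `a j` to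
be below only one `b`, and this makes two suitable jumps incompatible. -/
theorem false_of_rightBelowTop {I : Set (α × α)} {ι : Type*} [Nonempty ι]
    (C : StrictAlternatingCycle I ι) (hinc : ∀ i, ¬ C.a i ≤ C.b i) (hb : ∀ i, r ≤ C.b i)
    (hright : ∀ i, T.RightBelowTop (C.a i) (C.b i))
    (hord : (∀ i, T.path (C.a i) < T.path (C.b i)) ∨ ∀ i, T.path (C.b i) < T.path (C.a i)) :
    False := by
  obtain ⟨c, hc, hcmax⟩ := Set.exists_max_image {c | ∀ i, T.Anc c (C.b i)}
    (fun c => (T.path c).length) (Set.toFinite _) ⟨r, fun i => root_anc _⟩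
  -- `D i` represents the part of the subtree of `c` that contains `b i`.
  have hD : ∀ i, ∃ d, (d = c ∧ C.b i = c) ∨ (d ≠ r ∧ T.par d = c ∧ T.Anc d (C.b i)) := by
    intro i
    by_cases h : C.b i = c
    · exact ⟨c, Or.inl ⟨rfl, h⟩⟩
    · obtain ⟨d, h1, h2, h3⟩ := exists_child (hc i) (Ne.symm h)
      exact ⟨d, Or.inr ⟨h1, h2, h3⟩⟩
  choose D hD using hD
  have hD_child : ∀ i d, d ≠ r → T.par d = c → T.Anc d (C.b i) → D i = d := by
    intro i d hd hdc hdb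
    rcases hD i with ⟨_, h⟩ | ⟨h1, h2, h3⟩
    · rw [h, ← hdc] at hdb
      exact absurd ((par_anc hd).antisymm hdb) (par_ne hd)
    · exact child_unique h1 hd (h2.trans hdc.symm) h3 hdb
  obtain ⟨i₀, hi₀⟩ : ∃ i, D (C.succ i) ≠ D i := by
    by_contra! h
    obtain ⟨i⟩ := ‹Nonempty ι›
    have hconst := C.const_of_forall_succ h
    rcases hD i with ⟨h1, h2⟩ | ⟨h1, h2, h3⟩
    · have h4 : C.b (C.succ i) = c := by
        rcases hD (C.succ i) with ⟨_, h4⟩ | ⟨h3, h4, _⟩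
        · exact h4
        · rw [hconst _ i, h1] at h3 h4
          exact absurd h4 (par_ne h3)
      exact hinc i ((C.le_succ i).trans (h4.trans h2.symm).le)
    · have h4 : ∀ j, T.Anc (D i) (C.b j) := by
        intro j
        rcases hD j with ⟨h4, _⟩ | ⟨_, _, h4⟩
        · rw [hconst j i] at h4
          exact absurd (h2.trans h4.symm) (par_ne h1)
        · rwa [hconst j i] at h4
      have := hcmax _ h4
      rw [← h2] at this
      exact absurd (T.length_par_lt h1) (not_lt.2 this)
  -- The pairs at which the cycle leaves a part.
  have hjump : ∀ i, D (C.succ i) ≠ D i →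
      (∀ v, T.hi c = some v → ¬ C.a i ≤ v) ∧
      ((C.a i ≤ c ∧ D i ≠ c ∧ T.right (D i)) ∨
        ∃ u, T.lo c = some u ∧ C.a i ≤ u) := by
    intro i hi
    obtain ⟨d, hd, htop, hdr, hdb⟩ := hright i
    have hxb := (par_anc hd).trans hdb
    have hxb' := htop.2 _ (C.le_succ i)
    -- The top is an ancestor of both `b i` and `b (succ i)`, which lie in different parts, so it
    -- cannot be strictly below `c`.
    have hxc : T.Anc (T.par d) c := by
      by_contra h
      have h' := (hxb.total (hc i)).resolve_left h
      obtain ⟨e, he, hec, hex⟩ := exists_child h' (by rintro rfl; exact h (Anc.refl _))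
      exact hi ((hD_child _ e he hec (hex.trans hxb')).trans
        (hD_child _ e he hec (hex.trans hxb)).symm)
    by_cases hxc' : T.par d = c
    · refine ⟨fun v hv hav => ?_, Or.inl ⟨hxc' ▸ htop.1, ?_, ?_⟩⟩
      · exact Sep.not_anc (Or.inr hv) (hxc' ▸ htop.2 v hav)
      · rw [hD_child i d hd hxc' hdb, ← hxc']
        exact (par_ne hd).symm
      · rwa [hD_child i d hd hxc' hdb]
    · have hdc : T.Anc d c := by
        obtain ⟨e, he, hed, hec⟩ := exists_child hxc hxc'
        rwa [← child_unique he hd hed (hec.trans (hc i)) hdb]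
      obtain ⟨u, v, hu, hv, hau, hvb⟩ := exists_lo_hi hd htop hdr (hinc i) (hb i) (C.le_succ i) c
        hdc (hc i) (hc _)
      refine ⟨fun v' hv' hav => hinc i (hav.trans ?_), Or.inr ⟨u, hu, hau⟩⟩
      rw [hv] at hv'
      exact Option.some.inj hv' ▸ hvb
  have hsep_right : ∀ i, D i ≠ c → T.right (D i) → ∀ s, T.Sep (D i) s →
      s = c ∨ T.hi c = some s := by
    intro i hi hr s hs
    rcases hD i with ⟨h, _⟩ | ⟨h1, h2, _⟩
    · exact absurd h hi
    · exact h2 ▸ hs.of_right h1 hr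
  have hsep_left : ∀ i, D i ≠ c → ¬ T.right (D i) → ∀ s, T.Sep (D i) s →
      s = c ∨ T.lo c = some s := by
    intro i hi hr s hs
    rcases hD i with ⟨h, _⟩ | ⟨h1, h2, _⟩
    · exact absurd h hi
    · exact h2 ▸ hs.of_left h1 hr
  -- Not every jump goes to the part that contains `a i`.
  obtain ⟨i, hi, hia⟩ : ∃ i, D (C.succ i) ≠ D i ∧
      (D (C.succ i) ≠ c → ¬ T.Anc (D (C.succ i)) (C.a i)) := by
    by_contra! h
    have hne : ∀ i, D i ≠ c := by
      intro i hic
      obtain ⟨j, hj, hj'⟩ := C.exists_change_to hi₀ i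
      exact (h j hj').1 (hj.trans hic)
    have hchild := fun i => (hD i).resolve_left fun h => hne i h.1
    have heq : ∀ i, T.Anc (D i) (D (C.succ i)) ∨ T.Anc (D (C.succ i)) (D i) →
        D (C.succ i) = D i := by
      rintro i (h' | h')
      · exact child_unique (hchild _).1 (hchild i).1 ((hchild _).2.1.trans (hchild i).2.1.symm)
          (Anc.refl _) h'
      · exact child_unique (hchild _).1 (hchild i).1 ((hchild _).2.1.trans (hchild i).2.1.symm)
          h' (Anc.refl _)
    -- If every jump enters the part containing `a i`, the fixed order of `a i` and `b i` makes the
    -- parts move monotonically in the preorder; around a cycle they would be constant.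
    rcases hord with hord | hord
    · refine hi₀ (T.path_injective (C.antitone_const (f := fun i => T.path (D i)) (fun i => ?_) i₀))
      by_cases hi : D (C.succ i) = D i
      · rw [hi]
      · by_contra hlt
        exact hi (heq i (Or.inl ((Anc.refl _).of_le_of_le (hchild i).2.2 (not_le.1 hlt).le
          ((h i hi).2.path_le.trans (hord i).le))))
    · refine hi₀ (T.path_injective (OrderDual.toDual.injective
        (C.antitone_const (f := fun i => OrderDual.toDual (T.path (D i))) (fun i => ?_) i₀)))
      by_cases hi : D (C.succ i) = D i
      · rw [hi]
      · by_contra hlt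
        exact hi (heq i (Or.inr ((Anc.refl _).of_le_of_le (h i hi).2
          (not_le.1 (fun h' => hlt (OrderDual.toDual_le_toDual.2 h'))).le
          ((hchild i).2.2.path_le.trans (hord i).le))))
  obtain ⟨z, haz, hzb, hz⟩ : ∃ z, C.a i ≤ z ∧ z ≤ C.b (C.succ i) ∧
      (z = c ∨ (T.lo c = some z ∧ D (C.succ i) ≠ c ∧ ¬ T.right (D (C.succ i)))) := by
    rcases hD (C.succ i) with ⟨_, h2⟩ | ⟨h1, h2, h3⟩
    · exact ⟨c, h2 ▸ C.le_succ i, h2.ge, Or.inl rfl⟩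
    · have hne : D (C.succ i) ≠ c := by
        rw [← h2]
        exact (par_ne h1).symm
      obtain ⟨s, hs, has, hsb⟩ := exists_sep_of_ge (C.le_succ i) (hia hne) h3
      refine ⟨s, has, hsb, ?_⟩
      by_cases hr : T.right (D (C.succ i))
      · exact Or.inl ((hsep_right _ hne hr s hs).resolve_right fun h => (hjump i hi).1 s h has)
      · exact (hsep_left _ hne hr s hs).imp_right fun h => ⟨h, hne, hr⟩
  rcases hz with rfl | ⟨hz, hne, hleft⟩
  -- Here `a i ≤ c ≤ b (succ i)`. Compare with a jump `j` into the part that `i` leaves. Strictness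
  -- forbids `a j ≤ c`. If that part is a right branch, its separators `c` and `hi c` both fail to
  -- be above `a j`. If it is a left branch, both `c` and `lo c` are above `a i`, and one of them is
  -- below `b (succ j)`, giving `a i` a second successor.
  · obtain ⟨j, hj, hj'⟩ := C.exists_change_to hi₀ i
    have hij : j ≠ i := by
      rintro rfl
      exact hi hj
    have hsucc : C.succ i ≠ C.succ j := fun h => hi (h ▸ hj)
    have hjz : ¬ C.a j ≤ z := fun h => hsucc (C.eq_succ j _ (h.trans hzb))
    obtain ⟨u, hu, hju⟩ := (hjump j hj').2.resolve_left fun h => hjz h.1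
    rcases hD (C.succ j) with ⟨_, h2⟩ | ⟨h1, h2, h3⟩
    · exact hjz (h2 ▸ C.le_succ j)
    have hne : D (C.succ j) ≠ z := by
      rw [← h2]
      exact (par_ne h1).symm
    by_cases hr : T.right (D (C.succ j))
    · obtain ⟨s, hs, hjs⟩ : ∃ s, T.Sep (D (C.succ j)) s ∧ C.a j ≤ s := by
        by_cases h : T.Anc (D (C.succ j)) (C.a j)
        · have hnot : ¬ T.Anc (D (C.succ j)) u := fun h' =>
            Sep.not_anc (Or.inl hu) ((h2 ▸ par_anc h1 : T.Anc z _).trans h')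
          obtain ⟨s, hs, h, _⟩ := exists_sep_of_le hju h hnot
          exact ⟨s, hs, h⟩
        · obtain ⟨s, hs, h, _⟩ := exists_sep_of_ge (C.le_succ j) h h3
          exact ⟨s, hs, h⟩
      rcases hsep_right _ hne hr s hs with rfl | h
      · exact hjz hjs
      · exact (hjump j hj').1 s h hjs
    · obtain ⟨u', hu', hiu⟩ := (hjump i hi).2.resolve_left fun h => hr (hj ▸ h.2.2)
      obtain ⟨s, hs, hsb⟩ := exists_sep_le (hb _) h1 h3
      refine hsucc (C.eq_succ i _ ?_).symm
      rcases hsep_left _ hne hr s hs with rfl | h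
      · exact haz.trans hsb
      · rw [hu'] at h
        exact hiu.trans ((Option.some.inj h).le.trans hsb)
  -- Compare with a jump `j` out of the left branch entered by `i`: then `a j ≤ lo c ≤ b (succ i)`,
  -- so `j` and `i` have the same successor and `j` does not leave the branch.
  · obtain ⟨j, hj, hj'⟩ := C.exists_change_from hi₀ (C.succ i)
    obtain ⟨u, hu, hju⟩ := (hjump j hj').2.resolve_left fun h => hleft (hj ▸ h.2.2)
    rw [hz] at hu
    have := C.eq_succ j _ ((hju.trans (Option.some.inj hu).ge).trans hzb)
    exact hj' (this ▸ hj.symm)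

theorem isReversible_of_rightBelowTop {I : Set (α × α)} (hinc : I ⊆ incPairs α)
    (hb : ∀ p ∈ I, r ≤ p.2) (hright : ∀ p ∈ I, T.RightBelowTop p.1 p.2)
    (hord : (∀ p ∈ I, T.path p.1 < T.path p.2) ∨ ∀ p ∈ I, T.path p.2 < T.path p.1) :
    IsReversible I := by
  refine isReversible_of_isEmpty_cycle hinc fun D hD C => ?_
  have := hD.to_subtype
  exact false_of_rightBelowTop C (fun i => (hinc (C.mem i)).1) (fun i => hb _ (C.mem i))
    (fun i => hright _ (C.mem i)) (hord.imp (fun h i => h _ (C.mem i)) fun h i => h _ (C.mem i))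

/-- `b (succ i)` is in the subtree of `top (a i)`, an interval of the preorder that begins at `top
(a i)` and omits `b i`. So `b` moves strictly in one direction along the cycle. -/
theorem isReversible_of_not_anc_top {I : Set (α × α)} (hinc : I ⊆ incPairs α) {top : α → α}
    (htop : ∀ a, T.IsTop a (top a)) (hnot : ∀ p ∈ I, ¬ T.Anc (top p.1) p.2)
    (hord : (∀ p ∈ I, T.path p.2 < T.path (top p.1)) ∨
      ∀ p ∈ I, T.path (top p.1) < T.path p.2) :
    IsReversible I := by
  refine isReversible_of_isEmpty_cycle hinc fun D hD C => ?_
  obtain ⟨i⟩ := hD.to_subtype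
  have hanc : ∀ i, T.Anc (top (C.a i)) (C.b (C.succ i)) := fun i => (htop _).2 _ (C.le_succ i)
  rcases hord with hord | hord
  · have hlt : ∀ i, T.path (C.b i) < T.path (C.b (C.succ i)) := fun i =>
      (hord _ (C.mem i)).trans_le (hanc i).path_le
    have := C.antitone_const (f := fun i => OrderDual.toDual (T.path (C.b i)))
      (fun i => OrderDual.toDual_le_toDual.2 (hlt i).le) i
    exact (hlt i).ne (OrderDual.toDual.injective this).symm
  · have hlt : ∀ i, T.path (C.b (C.succ i)) < T.path (C.b i) := by
      intro i
      by_contra h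
      exact hnot _ (C.mem i) ((Anc.refl _).of_le_of_le (hanc i) (hord _ (C.mem i)).le (not_lt.1 h))
    exact (hlt i).ne (C.antitone_const (f := fun i => T.path (C.b i)) (fun i => (hlt i).le) i)

/-- The incomparable pairs whose second component is above the root fall into six reversible
classes. -/
theorem exists_fin_six_classes (T : LadderTree (SimpleGraph.hasse α) r) :
    ∃ f : α × α → Fin 6, ∀ I : Set (α × α), I ⊆ incPairs α → (∀ p ∈ I, r ≤ p.2) →
      (∃ k, ∀ p ∈ I, f p = k) → IsReversible I := by
  classical
  choose top htop using T.exists_top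
  have hbelow : ∀ p ∈ incPairs α, T.Anc (top p.1) p.2 →
      T.RightBelowTop p.1 p.2 ∨ T.mirror.RightBelowTop p.1 p.2 := by
    intro p hp h
    have hne : top p.1 ≠ p.2 := fun h' => hp.1 (h' ▸ (htop p.1).1)
    obtain ⟨d, hd, hdx, hdb⟩ := exists_child h hne
    by_cases hr : T.right d
    · exact Or.inl ⟨d, hd, hdx ▸ htop p.1, hr, hdb⟩
    · exact Or.inr ⟨d, hd, (hdx ▸ htop p.1 : T.IsTop _ _), hr, hdb⟩
  have hlt : ∀ p ∈ incPairs α, ¬ T.path p.1 < T.path p.2 → T.path p.2 < T.path p.1 := by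
    intro p hp h
    refine lt_of_le_of_ne (not_lt.1 h) fun h' => hp.1 (T.path_injective h').ge
  have hlt' : ∀ p : α × α, ¬ T.Anc (top p.1) p.2 → ¬ T.path p.2 < T.path (top p.1) →
      T.path (top p.1) < T.path p.2 := by
    intro p hp h
    refine lt_of_le_of_ne (not_lt.1 h) fun h' => hp (T.path_injective h' ▸ Anc.refl _)
  refine ⟨fun p =>
    if T.Anc (top p.1) p.2 then
      if T.RightBelowTop p.1 p.2 then
        if T.path p.1 < T.path p.2 then 0 else 1
      else if T.path p.1 < T.path p.2 then 2 else 3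
    else if T.path p.2 < T.path (top p.1) then 4 else 5, ?_⟩
  rintro I hinc hb ⟨k, hk⟩
  replace hbelow := fun p (hp : p ∈ I) => hbelow p (hinc hp)
  replace hlt := fun p (hp : p ∈ I) => hlt p (hinc hp)
  simp only at hk
  fin_cases k
  · exact isReversible_of_rightBelowTop (T := T) hinc hb (fun p hp => by grind)
      (Or.inl fun p hp => by grind)
  · exact isReversible_of_rightBelowTop (T := T) hinc hb (fun p hp => by grind)
      (Or.inr fun p hp => by grind)
  · exact isReversible_of_rightBelowTop (T := T.mirror) hinc hb (fun p hp => by grind)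
      (Or.inl fun p hp => by change T.path _ < T.path _; grind)
  · exact isReversible_of_rightBelowTop (T := T.mirror) hinc hb (fun p hp => by grind)
      (Or.inr fun p hp => by change T.path _ < T.path _; grind)
  · exact isReversible_of_not_anc_top hinc htop (fun p hp => by grind)
      (Or.inl fun p hp => by grind)
  · exact isReversible_of_not_anc_top hinc htop (fun p hp => by grind)
      (Or.inr fun p hp => by grind)

end LadderTree

/-! ### Subtrees of a rooted tree -/

namespace SimpleGraph

variable {N : Type*} {T : SimpleGraph N}

variable (T) in
/-- The step in `S` from a node of the tree `T` to the neighbour closer to `r`. -/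
def DownStep (r : N) (S : Set N) (t t' : N) : Prop :=
  t ∈ S ∧ t' ∈ S ∧ T.Adj t' t ∧ T.dist r t = T.dist r t' + 1

theorem IsTree.eq_of_downStep (hT : T.IsTree) {r t t₁ t₂ : N} {S S' : Set N}
    (h₁ : T.DownStep r S t t₁) (h₂ : T.DownStep r S' t t₂) : t₁ = t₂ := by
  obtain ⟨p₁, hp₁⟩ := hT.connected.exists_walk_length_eq_dist r t₁
  obtain ⟨p₂, hp₂⟩ := hT.connected.exists_walk_length_eq_dist r t₂
  have h₁' := (p₁.concat h₁.2.2.1).isPath_of_length_eq_dist (by simp [hp₁, h₁.2.2.2])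
  have h₂' := (p₂.concat h₂.2.2.1).isPath_of_length_eq_dist (by simp [hp₂, h₂.2.2.2])
  have := (hT.existsUnique_path r t).unique h₁' h₂'
  simpa using congrArg Walk.penultimate this

/-- Along a walk in `S` from `w`, a step away from `r` prepends to the descent, while a step towards
`r` follows the descent already found, because the downward neighbour is unique. -/
theorem IsTree.reflTransGen_downStep (hT : T.IsTree) {r w t : N} {S : Set N}
    (hS : (T.induce S).Connected) (hw : w ∈ S) (hmin : ∀ t ∈ S, T.dist r w ≤ T.dist r t)
    (ht : t ∈ S) : Relation.ReflTransGen (T.DownStep r S) t w := by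
  suffices h : ∀ t : S, Relation.ReflTransGen (T.DownStep r S) t w from h ⟨t, ht⟩
  intro t
  induction (reachable_iff_reflTransGen _ _).1 (hS.preconnected ⟨w, hw⟩ t) with
  | refl => exact .refl
  | @tail t t' _ hadj ih =>
    have hadj' : T.Adj t t' := hadj
    rcases hT.dist_eq_dist_add_one_of_adj r hadj' with h | h
    · have hstep : T.DownStep r S t t' := ⟨t.2, t'.2, hadj'.symm, h⟩
      rcases Relation.ReflTransGen.cases_head ih with h' | ⟨t₁, h₁, h₂⟩
      · have := hmin t' t'.2
        rw [h'] at h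
        omega
      · rwa [hT.eq_of_downStep hstep h₁]
    · exact .head ⟨t'.2, t.2, hadj', h⟩ ih

theorem dist_le_of_reflTransGen_downStep {r t w : N} {S : Set N}
    (h : Relation.ReflTransGen (T.DownStep r S) t w) : t = w ∨ T.dist r w < T.dist r t := by
  induction h with
  | refl => exact Or.inl rfl
  | tail _ h ih =>
    have := h.2.2.2
    rcases ih with rfl | ih <;> right <;> omega

/-- If two subtrees intersect, then the one whose top is farther from the root has its top in the
other one. -/
theorem IsTree.mem_of_dist_le (hT : T.IsTree) {r w w' : N} {S S' : Set N}
    (hS : (T.induce S).Connected) (hS' : (T.induce S').Connected) (hw : w ∈ S) (hw' : w' ∈ S')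
    (hmin : ∀ t ∈ S, T.dist r w ≤ T.dist r t) (hmin' : ∀ t ∈ S', T.dist r w' ≤ T.dist r t)
    (hne : (S ∩ S').Nonempty) (hle : T.dist r w ≤ T.dist r w') : w' ∈ S := by
  obtain ⟨t, ht, ht'⟩ := hne
  have h := hT.reflTransGen_downStep hS hw hmin ht
  have h' := hT.reflTransGen_downStep hS' hw' hmin' ht'
  clear ht ht'
  induction h using Relation.ReflTransGen.head_induction_on with
  | refl =>
    rcases dist_le_of_reflTransGen_downStep h' with rfl | h'
    · exact hw
    · omega
  | head h₁ _ ih =>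
    rcases Relation.ReflTransGen.cases_head h' with rfl | ⟨t₂, h₂, h₃⟩
    · exact h₁.1
    · exact ih (hT.eq_of_downStep h₁ h₂ ▸ h₃)

end SimpleGraph

/-! ### From tree decompositions to ladder trees -/

theorem exists_injective_refining {α : Type*} [Finite α] (key : α → ℕ) :
    ∃ rank : α → ℕ, Function.Injective rank ∧ ∀ x y, rank x ≤ rank y → key x ≤ key y := by
  obtain ⟨n, ⟨e⟩⟩ := Finite.exists_equiv_fin α
  -- A two-digit number in base `n` with leading digit `key x`; the last digit breaks ties.
  refine ⟨fun x => key x * n + e x, fun x y h => ?_, fun x y h => ?_⟩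
  · have hx := (e x).2
    have hy := (e y).2
    have hn : 0 < n := by omega
    have h1 := congrArg (· % n) h
    simp only [Nat.mul_add_mod', Nat.mod_eq_of_lt hx, Nat.mod_eq_of_lt hy] at h1
    exact e.injective (Fin.ext h1)
  · by_contra! hlt
    have hx := (e x).2
    have hy := (e y).2
    have := Nat.mul_le_mul_right n hlt
    rw [Nat.succ_mul] at this
    simp only at h
    omega

theorem exists_recursion {α β : Type*} {r : α} {rank : α → ℕ} {par : α → α}
    (hpar : ∀ n, n ≠ r → rank (par n) < rank n) (b : β) (g : α → β → β) :
    ∃ f : α → β, f r = b ∧ ∀ n, n ≠ r → f n = g n (f (par n)) := by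
  classical
  let F : ∀ n, (∀ m, rank m < rank n → β) → β := fun n f =>
    if h : n = r then b else g n (f (par n) (hpar n h))
  refine ⟨(measure rank).wf.fix F, ?_, fun n hn => ?_⟩
  · rw [WellFounded.fix_eq]
    simp [F]
  · rw [WellFounded.fix_eq]
    simp [F, hn]

/-- A vertex ordering in which every vertex has at most two earlier neighbours, the last of which is
joined to the other, yields a ladder tree. -/
theorem exists_ladderTree {α : Type*} {G : SimpleGraph α} {r : α} {rank : α → ℕ}
    (hrank : Function.Injective rank) (hroot : ∀ n, n ≠ r → rank r < rank n) (M : α → Set α)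
    (hlt : ∀ n, ∀ m ∈ M n, rank m < rank n) (hcard : ∀ n, (M n).encard ≤ 2)
    (hM : ∀ n, ∀ m ∈ M n, ∀ m' ∈ M n, rank m < rank m' → m ∈ M m')
    (hadj : ∀ x y, G.Adj x y → x ∈ M y ∨ y ∈ M x) : Nonempty (LadderTree G r) := by
  classical
  have hfin : ∀ n, (M n).Finite := fun n =>
    Set.finite_of_encard_le_coe (k := 2) (by exact_mod_cast hcard n)
  have hex : ∀ n, ∃ p, n ≠ r → rank p < rank n ∧
      ∀ m ∈ M n, m = p ∨ (p ∈ M n ∧ m ∈ M p) := by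
    intro n
    rcases (M n).eq_empty_or_nonempty with h | h
    -- Without earlier neighbours any earlier vertex may serve as parent; the root is one.
    · exact ⟨r, fun hn => ⟨hroot n hn, by simp [h]⟩⟩
    · obtain ⟨p, hp, hmax⟩ := Set.exists_max_image (M n) rank (hfin n) h
      refine ⟨p, fun _ => ⟨hlt n p hp, fun m hm => ?_⟩⟩
      by_cases hmp : m = p
      · exact Or.inl hmp
      · exact Or.inr ⟨hp, hM n m hm p hp (lt_of_le_of_ne (hmax m hm) fun h => hmp (hrank h))⟩
  choose par hpar using hex
  obtain ⟨path, hpath_root, hpath⟩ := exists_recursion (fun n hn => (hpar n hn).1) []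
    (fun n l => l ++ [rank n])
  -- The pair `(lo, hi)`: the parent replaces `hi` when `M n` needs the inherited `lo`, and replaces
  -- `lo` otherwise.
  obtain ⟨f, hf_root, hf⟩ := exists_recursion (β := Option α × Option α)
    (fun n hn => (hpar n hn).1) (none, none)
    (fun n q => if ∃ s ∈ M n, q.1 = some s then (q.1, some (par n)) else (some (par n), q.2))
  have hflt : ∀ n s, (f n).1 = some s ∨ (f n).2 = some s → rank s < rank n := by
    intro n
    induction hk : rank n using Nat.strong_induction_on generalizing n with
    | _ k ih =>
      intro s hs
      by_cases hn : n = r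
      · simp [hn, hf_root] at hs
      · have h1 := hk ▸ (hpar n hn).1
        have key : par n = s ∨ (f (par n)).1 = some s ∨ (f (par n)).2 = some s := by
          rw [hf n hn] at hs
          split_ifs at hs <;> simp only [Option.some.injEq] at hs <;> tauto
        rcases key with rfl | key
        · exact h1
        · exact (ih _ h1 _ rfl s key).trans h1
  have hMsep : ∀ n, ∀ m ∈ M n, (f n).1 = some m ∨ (f n).2 = some m := by
    intro n
    induction hk : rank n using Nat.strong_induction_on generalizing n with
    | _ k ih =>
      intro m hm
      have hn : n ≠ r := by
        rintro rfl
        by_cases h : m = n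
        · exact absurd (hlt n m hm) (h ▸ lt_irrefl _)
        · exact absurd (hlt n m hm) (hroot m h).asymm
      obtain ⟨h1, h2⟩ := hpar n hn
      rw [hf n hn]
      rcases h2 m hm with rfl | ⟨hp, hmp⟩
      · split_ifs <;> simp
      · by_cases h : (f (par n)).1 = some m
        · rw [if_pos ⟨m, hm, h⟩]
          exact Or.inl h
        · rw [if_neg]
          · exact Or.inr ((ih _ (hk ▸ h1) (par n) rfl m hmp).resolve_left h)
          · rintro ⟨s, hs, hs'⟩
            -- If both inherited ends were needed, they and the parent would be three elements of `M
            -- n`.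
            have hmp' : m ≠ par n := fun h => (hlt _ _ hmp).ne (congrArg rank h)
            have hsp : s ≠ par n := fun h => (hflt _ s (Or.inl hs')).ne (congrArg rank h)
            have hsm : s ≠ m := fun h' => h (h' ▸ hs')
            have : ({s, m, par n} : Set α).encard ≤ 2 :=
              (Set.encard_le_encard (by
                rintro x (rfl | rfl | rfl) <;> assumption)).trans (hcard n)
            rw [Set.encard_insert_of_notMem (by simp [hsm, hsp]), Set.encard_pair hmp'] at this
            exact absurd this (by norm_num)
  refine ⟨⟨par, fun n => ¬ ∃ s ∈ M n, (f (par n)).1 = some s, fun n => (f n).1, fun n => (f n).2,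
    path, ?_, fun n hn => ⟨_, hpath n hn⟩, by simp [hf_root], by simp [hf_root], ?_, ?_, ?_, ?_, ?_⟩⟩
  · intro n m h
    by_cases hn : n = r <;> by_cases hm : m = r
    · exact hn.trans hm.symm
    · rw [hn, hpath_root, hpath m hm] at h
      simp at h
    · rw [hm, hpath_root, hpath n hn] at h
      simp at h
    · rw [hpath n hn, hpath m hm] at h
      exact hrank (by simpa using (List.append_inj' h rfl).2)
  · intro n hn h
    simp only [hf n hn, if_neg h]
  · intro n hn h
    simp only [hf n hn, if_neg h]
  · intro n hn h
    simp only [hf n hn, if_pos (not_not.1 h)]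
  · intro n hn h
    simp only [hf n hn, if_pos (not_not.1 h)]
  · intro x y h
    rcases hadj x y h with h | h
    · rcases hMsep _ _ h with h | h <;> simp [h]
    · rcases hMsep _ _ h with h | h <;> simp [h]

/-- Root the decomposition at a node of `r` and order the vertices by the depth of the top node `w
x` of their subtrees. The earlier vertices whose subtrees contain `w n` share a bag with `n`, so
there are at most two, and their subtrees meet pairwise at `w n`. -/
theorem exists_ladderTree_of_treewidth_le_two {α : Type*} [Finite α] {G : SimpleGraph α}
    (h : G.treewidth ≤ 2) (r : α) : Nonempty (LadderTree G r) := by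
  classical
  set S := {t : ℕ∞ | ∃ (N : Type) (_ : Finite N) (T : SimpleGraph N) (D : G.TreeDecomposition T),
    t ≠ ⊤ ∧ ∀ u, (D.bag u).encard ≤ t + 1} with hS
  have hne : S.Nonempty := by
    by_contra hempty
    have h' : sInf S ≤ 2 := h
    rw [Set.not_nonempty_iff_eq_empty.1 hempty, sInf_empty] at h'
    exact absurd h' (by decide)
  obtain ⟨N, _, T, D, _, hbag⟩ := csInf_mem hne
  replace hbag : ∀ u, (D.bag u).encard ≤ 3 := fun u =>
    (hbag u).trans (by
      have : sInf S + 1 ≤ 2 + 1 := add_le_add_left h 1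
      exact this.trans (by norm_num))
  have hT := D.isTree
  obtain ⟨⟨u₀, hu₀⟩⟩ := (D.connected r).nonempty
  have hw : ∀ x, ∃ w ∈ D.nodes x, ∀ t ∈ D.nodes x, T.dist u₀ w ≤ T.dist u₀ t := by
    intro x
    obtain ⟨⟨u, hu⟩⟩ := (D.connected x).nonempty
    exact Set.exists_min_image _ _ (Set.toFinite _) ⟨u, hu⟩
  choose w hw hmin using hw
  have hwr : T.dist u₀ (w r) = 0 := by
    have := hmin r u₀ hu₀
    simpa using this
  -- The shift by one puts `r` strictly before other vertices whose top node is also `u₀`.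
  obtain ⟨rank, hinj, hrank⟩ :=
    exists_injective_refining fun x => if x = r then 0 else T.dist u₀ (w x) + 1
  have hdist : ∀ x y, rank x ≤ rank y → T.dist u₀ (w x) ≤ T.dist u₀ (w y) := by
    intro x y hxy
    have := hrank x y hxy
    by_cases hx : x = r
    · simp [hx, hwr]
    · by_cases hy : y = r
      · simp [hx, hy] at this
      · simpa [hx, hy] using this
  have hmem : ∀ x y, (D.nodes x ∩ D.nodes y).Nonempty → rank x ≤ rank y → w y ∈ D.nodes x :=
    fun x y hxy hle => hT.mem_of_dist_le (D.connected x) (D.connected y) (hw x) (hw y) (hmin x)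
      (hmin y) hxy (hdist x y hle)
  refine exists_ladderTree hinj (fun n hn => ?_) (fun n => {m | rank m < rank n ∧ w n ∈ D.nodes m})
    (fun n m hm => hm.1) (fun n => ?_) (fun n m hm m' hm' hlt => ?_) (fun x y hxy => ?_)
  · by_contra hle
    have := hrank n r (not_lt.1 hle)
    simp [hn] at this
  · have hsub : insert n {m | rank m < rank n ∧ w n ∈ D.nodes m} ⊆ D.bag (w n) := by
      rintro m (rfl | hm)
      · exact hw m
      · exact hm.2
    have := (Set.encard_le_encard hsub).trans (hbag _)
    rw [Set.encard_insert_of_notMem (by simp)] at this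
    exact (ENat.add_le_add_iff_right (by norm_num : (1 : ℕ∞) ≠ ⊤)).1 (this.trans (by norm_num))
  · exact ⟨hlt, hmem m m' ⟨w n, hm.2, hm'.2⟩ hlt.le⟩
  · have hne := D.inter_nonempty x y hxy
    rcases lt_or_gt_of_ne (fun h => hxy.ne (hinj h)) with hlt | hlt
    · exact Or.inl ⟨hlt, hmem x y hne hlt.le⟩
    · exact Or.inr ⟨hlt, hmem y x (Set.inter_comm _ _ ▸ hne) hlt.le⟩

/-! ### The partition -/

theorem theorem2 {α : Type*} [PartialOrder α] [Finite α]
    (htw : (SimpleGraph.hasse α).treewidth ≤ 2)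
    (a₀ : α) (hmin : IsMin a₀) (hlt : ∀ b : α, IsMax b → a₀ < b) :
    ∃ I : Fin 638 → Set (α × α),
      (⋃ i, I i) = minMaxPairs α ∧
      (∀ i j, i ≠ j → Disjoint (I i) (I j)) ∧
      ∀ i, IsReversible (I i) := by
  obtain ⟨T⟩ := exists_ladderTree_of_treewidth_le_two htw a₀
  obtain ⟨f, hf⟩ := T.exists_fin_six_classes
  -- The six classes take the first six indices; the other sets are empty.
  refine ⟨fun i => {p | p ∈ minMaxPairs α ∧ Fin.castLE (by norm_num) (f p) = i}, ?_, ?_, ?_⟩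
  · ext p
    simp
  · intro i j hij
    exact Set.disjoint_left.2 fun p hp hp' => hij (hp.2.symm.trans hp'.2)
  · intro i
    refine hf _ (fun p hp => hp.1.1) (fun p hp => (hlt _ hp.1.2.2).le) ?_
    by_cases h : ∃ k : Fin 6, Fin.castLE (by norm_num) k = i
    · obtain ⟨k, hk⟩ := h
      exact ⟨k, fun p hp => Fin.castLE_injective (by norm_num) (hp.2.trans hk.symm)⟩
    · exact ⟨0, fun p hp => absurd ⟨f p, hp.2⟩ h⟩
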